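/- Let $\alpha\in\mathbb{R}\setminus\mathbb{Q}$ have continued fraction approximants $p_n/q_n$, let $\beta=\limsup_{n\to\infty}\frac{\ln q_{n+1}}{q_n}$ and assume $0<\beta<\infty$. Let $\mathscr{R}=\mathscr{R}_1\cup\mathscr{R}_2$, where $\mathscr{R}_1$ is the set of $\theta\in\mathbb{R}$ such that $|\sin\pi(2\theta+k\alpha)|\le k^{-2}$ for infinitely many $k\in\mathbb{Z}$, and $\mathscr{R}_2$ is the set of $\theta\in\mathbb{R}$ such that $2\theta+s\alpha\in\mathbb{Z}$ for some $s\in\mathbb{Z}$. For $n\ge 0$ and an integer $\ell$ with $1\le\ell\le q_{n+1}^{8/9}/q_n$ define the integer intervals $$I_1=\left[-[\tfrac23q_n],\,[\tfrac23q_n]-2\right],\qquad I_2=\left[(\ell-1)q_n+[\tfrac23q_n]-1,\,(\ell+1)q_n-[\tfrac23q_n]-1\right],$$ where $[\cdot]$ is the integer part. For $\theta\in\mathbb{R}$ put $\theta_j=\theta+j\alpha$. Let $\theta\notin\mathscr{R}$ and $\varepsilon>0$. Then there is $N$, depending only on $\alpha,\theta,\varepsilon$, such that for all $n\ge N$ and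 all integers $\ell$ with $1\le\ell\le q_{n+1}^{8/9}/q_n$ the set $I_1\cup I_2$ has exactly $2q_n$ elements and the family $\{\theta_j\}_{j\in I_1\cup I_2}$ is $(\frac{\beta}{2}+\varepsilon)$-uniform, that is, the numbers $\cos2\pi\theta_j$, $j\in I_1\cup I_2$, are pairwise distinct and $$\max_{x\in[-1,1]}\ \max_{i\in I_1\cup I_2}\ \prod_{\substack{j\in I_1\cup I_2\\ j\ne i}}\frac{|x-\cos2\pi\theta_j|}{|\cos2\pi\theta_i-\cos2\pi\theta_j|}<e^{(2q_n-1)\left(\frac{\beta}{2}+\varepsilon\right)}.$$ -/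

import Mathlib

namespace AlmostMathieu

/-- The denominator `q_n` (`q_0 = 1`) of the `n`-th continued fraction approximant `p_n / q_n` of
`α`, as a natural number. Mathlib has it as a real number; no information is lost by the floor,
see `q_cast`. -/
noncomputable def q (α : ℝ) (n : ℕ) : ℕ := ⌊(GenContFract.of α).dens n⌋₊

theorem contsAux_b_nat (α : ℝ) (n : ℕ) :
    (∃ m : ℕ, ((GenContFract.of α).contsAux n).b = m) ∧
      ∃ m : ℕ, ((GenContFract.of α).contsAux (n + 1)).b = m := by
  induction n with
  | zero => exact ⟨⟨0, by simp [GenContFract.contsAux]⟩, ⟨1, by simp [GenContFract.contsAux]⟩⟩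
  | succ n ih =>
    obtain ⟨⟨a, ha⟩, ⟨b, hb⟩⟩ := ih
    refine ⟨⟨b, hb⟩, ?_⟩
    cases h : (GenContFract.of α).s.get? n with
    | none => exact ⟨b, by rw [GenContFract.contsAux]; simpa [h] using hb⟩
    | some gp =>
      obtain ⟨h1, z, hz⟩ := GenContFract.of_partNum_eq_one_and_exists_int_partDen_eq h
      have hpos : (1 : ℝ) ≤ gp.b :=
        GenContFract.of_one_le_get?_partDen (GenContFract.partDen_eq_s_b h)
      rw [hz] at hpos
      have hz0 : 0 ≤ z := by
        have : (1 : ℤ) ≤ z := by exact_mod_cast hpos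
        omega
      lift z to ℕ using hz0
      refine ⟨z * b + a, ?_⟩
      rw [GenContFract.contsAux_recurrence h rfl rfl]
      simp [h1, hz, ha, hb]

/-- `q α n` really is the denominator of the `n`-th approximant. -/
theorem q_cast (α : ℝ) (n : ℕ) : (q α n : ℝ) = (GenContFract.of α).dens n := by
  obtain ⟨m, hm⟩ := (contsAux_b_nat α n).2
  have : (GenContFract.of α).dens n = m := hm
  rw [q, this, Nat.floor_natCast]

/-- `β(α) = limsup_{n → ∞} (ln q_{n+1}) / q_n`, with values in the extended reals. -/
noncomputable def beta (α : ℝ) : EReal :=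
  Filter.limsup (fun n : ℕ => ((Real.log (q α (n + 1)) / (q α n : ℝ) : ℝ) : EReal)) Filter.atTop

/-- The phases `θ` with `|sin π(2θ + kα)| ≤ k⁻²` for infinitely many integers `k`. -/
def R₁ (α : ℝ) : Set ℝ :=
  {θ | {k : ℤ | |Real.sin (Real.pi * (2 * θ + k * α))| ≤ ((k : ℝ) ^ 2)⁻¹}.Infinite}

/-- The phases `θ` with `2θ + sα ∈ ℤ` for some integer `s`. -/
def R₂ (α : ℝ) : Set ℝ :=
  {θ | ∃ s m : ℤ, 2 * θ + s * α = m}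

/-- The set of resonant phases. -/
def R (α : ℝ) : Set ℝ := R₁ α ∪ R₂ α

/-- The integer block `[-[2q/3], [2q/3] - 2]`; the division is integer division, so that
`2 * q / 3` is the integer part of `2q/3`. -/
noncomputable def I₁ (q : ℕ) : Finset ℤ :=
  Finset.Icc (-(2 * (q : ℤ) / 3)) (2 * (q : ℤ) / 3 - 2)

/-- The integer block `[(ℓ-1)q + [2q/3] - 1, (ℓ+1)q - [2q/3] - 1]`. -/
noncomputable def I₂ (q ℓ : ℕ) : Finset ℤ :=
  Finset.Icc (((ℓ : ℤ) - 1) * q + 2 * (q : ℤ) / 3 - 1) (((ℓ : ℤ) + 1) * q - 2 * (q : ℤ) / 3 - 1)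

/-- `ε`-uniformity of a family of `k + 1` phases `θ j`, `j ∈ J`:
`max_{x ∈ [-1,1]} max_{i ∈ J} ∏_{j ∈ J, j ≠ i} |x - cos 2πθ_j| / |cos 2πθ_i - cos 2πθ_j| < e^{kε}`.
The maxima range over a compact and a finite set, so the bound is the pointwise one. That there are
`k + 1` phases and that no denominator vanishes is part of the notion. -/
def IsUniform {ι : Type*} [DecidableEq ι] (J : Finset ι) (θ : ι → ℝ) (k : ℕ) (ε : ℝ) : Prop :=
  J.card = k + 1 ∧
  Set.InjOn (fun j => Real.cos (2 * Real.pi * θ j)) (J : Set ι) ∧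
  ∀ x ∈ Set.Icc (-1 : ℝ) 1, ∀ i ∈ J,
    ∏ j ∈ J.erase i,
      |x - Real.cos (2 * Real.pi * θ j)| /
        |Real.cos (2 * Real.pi * θ i) - Real.cos (2 * Real.pi * θ j)| < Real.exp (k * ε)

end AlmostMathieu

namespace AlmostMathieu

section

open Filter Topology

theorem not_terminatedAt_of_irrational {α : ℝ} (hα : Irrational α) (n : ℕ) :
    ¬(GenContFract.of α).TerminatedAt n := fun h =>
  hα (by
    obtain ⟨r, hr⟩ := (GenContFract.terminates_iff_rat α).1 ⟨n, h⟩
    exact ⟨r, hr.symm⟩)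

theorem fib_le_q {α : ℝ} (hα : Irrational α) (n : ℕ) : Nat.fib (n + 1) ≤ q α n := by
  have h := GenContFract.succ_nth_fib_le_of_nth_den (v := α) (n := n)
    (Or.inr (not_terminatedAt_of_irrational hα _))
  rw [← q_cast] at h
  exact_mod_cast h

theorem q_pos {α : ℝ} (hα : Irrational α) (n : ℕ) : 0 < q α n :=
  (Nat.fib_pos.2 n.succ_pos).trans_le (fib_le_q hα n)

theorem q_le_succ (α : ℝ) (n : ℕ) : q α n ≤ q α (n + 1) := by
  have h := GenContFract.of_den_mono (v := α) (n := n)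
  rw [← q_cast, ← q_cast] at h
  exact_mod_cast h

theorem tendsto_q {α : ℝ} (hα : Irrational α) : Tendsto (q α) atTop atTop := by
  refine tendsto_atTop_atTop.2 fun b => ⟨b + 5, fun n hn => ?_⟩
  have := Nat.le_fib_self (n := n + 1) (by omega)
  have := fib_le_q hα n
  omega

theorem add_q_le_q {α : ℝ} (hα : Irrational α) (n : ℕ) :
    q α n + q α (n + 1) ≤ q α (n + 2) := by
  obtain ⟨gp, h⟩ := Option.ne_none_iff_exists'.1 (not_terminatedAt_of_irrational hα (n + 1))
  obtain ⟨h1, -⟩ := GenContFract.of_partNum_eq_one_and_exists_int_partDen_eq h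
  have hb : (1 : ℝ) ≤ gp.b := GenContFract.of_one_le_get?_partDen (GenContFract.partDen_eq_s_b h)
  have hr := GenContFract.dens_recurrence h rfl rfl
  rw [← q_cast, ← q_cast, ← q_cast, h1] at hr
  have : (q α n : ℝ) + q α (n + 1) ≤ q α (n + 2) := by
    rw [hr]
    nlinarith [Nat.cast_nonneg (α := ℝ) (q α (n + 1))]
  exact_mod_cast this

theorem contsAux_a_int (α : ℝ) (n : ℕ) :
    (∃ m : ℤ, ((GenContFract.of α).contsAux n).a = m) ∧
      ∃ m : ℤ, ((GenContFract.of α).contsAux (n + 1)).a = m := by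
  induction n with
  | zero => exact ⟨⟨1, by simp [GenContFract.contsAux]⟩, ⟨⌊α⌋, by simp [GenContFract.contsAux]⟩⟩
  | succ n ih =>
    obtain ⟨⟨a, ha⟩, ⟨b, hb⟩⟩ := ih
    refine ⟨⟨b, hb⟩, ?_⟩
    cases h : (GenContFract.of α).s.get? n with
    | none => exact ⟨b, by rw [GenContFract.contsAux]; simpa [h] using hb⟩
    | some gp =>
      obtain ⟨h1, z, hz⟩ := GenContFract.of_partNum_eq_one_and_exists_int_partDen_eq h
      refine ⟨z * b + a, ?_⟩
      rw [GenContFract.contsAux_recurrence h rfl rfl]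
      simp [h1, hz, ha, hb]

/-- The numerator of the `n`-th approximant: coprimality and the quality of approximation. -/
theorem exists_numerator {α : ℝ} (hα : Irrational α) (n : ℕ) :
    ∃ p : ℤ, IsCoprime p (q α n : ℤ) ∧ |q α n * α - p| ≤ 1 / q α (n + 1) ∧
      1 / (2 * q α (n + 1)) ≤ |q α n * α - p| := by
  obtain ⟨p, hp⟩ := (contsAux_a_int α n).2
  obtain ⟨p', hp'⟩ := (contsAux_a_int α (n + 1)).2
  have hp : (GenContFract.of α).nums n = p := hp
  have hp' : (GenContFract.of α).nums (n + 1) = p' := hp'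
  have hdet := (SimpContFract.of α).determinant (not_terminatedAt_of_irrational hα n)
  change (GenContFract.of α).nums n * (GenContFract.of α).dens (n + 1) -
    (GenContFract.of α).dens n * (GenContFract.of α).nums (n + 1) = _ at hdet
  rw [hp, hp', ← q_cast, ← q_cast] at hdet
  have hdetZ : p * (q α (n + 1) : ℤ) - (q α n : ℤ) * p' = (-1) ^ (n + 1) := by exact_mod_cast hdet
  have h1 := GenContFract.abs_sub_convs_le (not_terminatedAt_of_irrational hα n)
  have h2 := GenContFract.abs_sub_convs_le (not_terminatedAt_of_irrational hα (n + 1))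
  rw [GenContFract.conv_eq_num_div_den, hp, ← q_cast, ← q_cast] at h1
  rw [GenContFract.conv_eq_num_div_den, hp', ← q_cast, ← q_cast] at h2
  have q0 : (0 : ℝ) < q α n := by exact_mod_cast q_pos hα n
  have q1 : (0 : ℝ) < q α (n + 1) := by exact_mod_cast q_pos hα (n + 1)
  have q2 : (0 : ℝ) < q α (n + 2) := by exact_mod_cast q_pos hα (n + 2)
  have h01 : (q α n : ℝ) ≤ q α (n + 1) := by exact_mod_cast q_le_succ α n
  have h02 : (q α n : ℝ) + q α (n + 1) ≤ q α (n + 2) := by exact_mod_cast add_q_le_q hα n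
  have hmul : |q α n * α - p| = q α n * |α - p / q α n| := by
    rw [← abs_of_pos q0, ← abs_mul, abs_of_pos q0]
    congr 1
    field_simp
  refine ⟨p, ?_, ?_, ?_⟩
  · rcases neg_one_pow_eq_or ℤ (n + 1) with h | h <;> rw [h] at hdetZ
    · exact ⟨q α (n + 1), -p', by linarith⟩
    · exact ⟨-q α (n + 1), p', by linarith⟩
  · rw [hmul]
    calc _ ≤ (q α n : ℝ) * (1 / (q α n * q α (n + 1))) := by gcongr
      _ = _ := by field_simp
  · rw [hmul]
    have hd : |(p : ℝ) / q α n - p' / q α (n + 1)| = 1 / (q α n * q α (n + 1)) := by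
      have : (p : ℝ) / q α n - p' / q α (n + 1) = (-1) ^ (n + 1) / (q α n * q α (n + 1)) := by
        rw [← hdet]
        field_simp
      rw [this, abs_div, abs_pow, abs_neg, abs_one, one_pow, abs_of_pos (mul_pos q0 q1)]
    have h3 : 1 / ((q α n : ℝ) * q α (n + 1)) ≤
        |α - p / q α n| + 1 / (q α (n + 1) * q α (n + 2)) := by
      rw [← hd]
      refine (abs_sub_le _ α _).trans ?_
      rw [abs_sub_comm _ α]
      gcongr
    have h4 : 1 / ((q α (n + 1) : ℝ) * q α (n + 2)) ≤ 1 / (2 * (q α n * q α (n + 1))) := by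
      apply one_div_le_one_div_of_le (by positivity)
      nlinarith
    calc 1 / (2 * (q α (n + 1) : ℝ))
        = q α n * (1 / (q α n * q α (n + 1)) - 1 / (2 * (q α n * q α (n + 1)))) := by
          field_simp; norm_num
      _ ≤ _ := by
          gcongr
          linarith

end

section

open Finset Real

@[to_additive]
theorem prod_Ico_of_periodic {M : Type*} [CommMonoid M] {F : ℤ → M} {q : ℕ}
    (hF : Function.Periodic F (q : ℤ)) (a : ℤ) :
    ∏ j ∈ Ico a (a + q), F j = ∏ r ∈ range q, F r := by
  have himg := Int.image_Ico_emod a (q : ℤ) (by positivity)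
  have hinj : Set.InjOn (· % (q : ℤ)) (Ico a (a + q) : Finset ℤ) := by
    rw [← card_image_iff, himg]
    simp
  calc ∏ j ∈ Ico a (a + q), F j = ∏ j ∈ Ico a (a + q), F (j % q) :=
        prod_congr rfl fun j _ => by
          have := hF.int_mul (j / q) (j % q)
          rwa [mul_comm, Int.cast_id, Int.emod_add_mul_ediv] at this
    _ = ∏ j ∈ Ico (0 : ℤ) q, F j := by rw [← himg, prod_image hinj]
    _ = _ := by
      refine (prod_nbij (fun r : ℕ => (r : ℤ)) ?_ ?_ ?_ ?_).symm
      · intro r hr; simpa using hr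
      · intro r _ s _ h; simpa using h
      · intro j hj
        simp only [coe_Ico, Set.mem_Ico] at hj
        exact ⟨j.toNat, by simp; omega, by simp; omega⟩
      · intro _ _; rfl

@[to_additive]
theorem prod_Ico_mul_prod_Ico {M : Type*} [CommMonoid M] (F : ℤ → M) {a b c : ℤ} (hab : a ≤ b)
    (hbc : b ≤ c) : (∏ j ∈ Ico a b, F j) * ∏ j ∈ Ico b c, F j = ∏ j ∈ Ico a c, F j := by
  rw [← Ico_union_Ico_eq_Ico hab hbc, prod_union (Ico_disjoint_Ico_consecutive a b c)]

theorem disjoint_blocks {q ℓ : ℕ} (hℓ : 1 ≤ ℓ) : Disjoint (I₁ q) (I₂ q ℓ) := by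
  rw [Finset.disjoint_left]
  intro j hj hj'
  simp only [I₁, I₂, mem_Icc] at hj hj'
  have : 0 ≤ ((ℓ : ℤ) - 1) * q := mul_nonneg (by omega) (by positivity)
  omega

/-- The two blocks together meet every residue class modulo `q` exactly twice. -/
@[to_additive]
theorem prod_blocks_of_periodic {M : Type*} [CommMonoid M] {F : ℤ → M} {q ℓ : ℕ} (hq : 2 ≤ q)
    (hℓ : 1 ≤ ℓ) (hF : Function.Periodic F (q : ℤ)) :
    ∏ j ∈ I₁ q ∪ I₂ q ℓ, F j = (∏ r ∈ range q, F r) * ∏ r ∈ range q, F r := by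
  set m : ℤ := 2 * (q : ℤ) / 3 with hm
  have h2 : ∏ j ∈ I₂ q ℓ, F j = ∏ j ∈ Ico (m - 1) (2 * q - m), F j := by
    refine (prod_nbij (fun j => j + ((ℓ : ℤ) - 1) * q) ?_ ?_ ?_ ?_).symm
    · intro j hj
      simp only [mem_Ico] at hj
      simp only [I₂, mem_Icc, ← hm]
      constructor <;> linarith
    · intro a _ b _ h; simpa using h
    · intro j hj
      simp only [I₂, coe_Icc, Set.mem_Icc, ← hm] at hj
      refine ⟨j - ((ℓ : ℤ) - 1) * q, ?_, by simp⟩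
      simp only [coe_Ico, Set.mem_Ico]
      constructor <;> linarith
    · intro j _
      have := hF.int_mul ((ℓ : ℤ) - 1) j
      simpa using this.symm
  have h1 : I₁ q = Ico (-m) (m - 1) := by
    ext j
    simp only [I₁, mem_Icc, mem_Ico, ← hm]
    omega
  rw [prod_union (disjoint_blocks hℓ), h2, h1,
    prod_Ico_mul_prod_Ico F (by omega) (by omega),
    ← prod_Ico_mul_prod_Ico F (show -m ≤ -m + q by omega) (by omega),
    prod_Ico_of_periodic hF, show (2 * q - m : ℤ) = -m + q + q by ring, prod_Ico_of_periodic hF]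

theorem card_blocks {q ℓ : ℕ} (hq : 2 ≤ q) (hℓ : 1 ≤ ℓ) : #(I₁ q ∪ I₂ q ℓ) = 2 * q := by
  rw [card_eq_sum_ones, sum_blocks_of_periodic hq hℓ (fun _ => rfl)]
  simp
  ring

theorem card_filter_blocks {q ℓ : ℕ} (hq : 2 ≤ q) (hℓ : 1 ≤ ℓ) (P : ℤ → Prop) [DecidablePred P]
    (hP : ∀ j, P (j + q) ↔ P j) :
    #{j ∈ I₁ q ∪ I₂ q ℓ | P j} = 2 * #{r ∈ range q | P (r : ℕ)} := by
  rw [card_filter, card_filter, sum_blocks_of_periodic hq hℓ, two_mul]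
  intro j
  simp [hP]

theorem card_blocks_filter_dvd {q ℓ : ℕ} (hq : 2 ≤ q) (hℓ : 1 ≤ ℓ) (i : ℤ) :
    #{j ∈ I₁ q ∪ I₂ q ℓ | (q : ℤ) ∣ j - i} = 2 := by
  rw [card_filter_blocks hq hℓ]
  · have hq0 : (q : ℤ) ≠ 0 := by omega
    have : ({r ∈ range q | (q : ℤ) ∣ (r : ℤ) - i} : Finset ℕ) = {(i % q).toNat} := by
      ext r
      have h0 := Int.emod_nonneg i hq0
      have h1 := Int.emod_lt_of_pos i (show (0 : ℤ) < q by omega)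
      simp only [mem_filter, mem_range, mem_singleton]
      constructor
      · rintro ⟨hr, hd⟩
        have h2 : i % q = (r : ℤ) % q := Int.modEq_iff_dvd.2 hd
        rw [Int.emod_eq_of_lt (a := (r : ℤ)) (by omega) (by omega)] at h2
        omega
      · intro h
        refine ⟨by omega, ?_⟩
        have : (r : ℤ) = i % q := by omega
        rw [this]
        exact Int.modEq_iff_dvd.1 (Int.mod_modEq i q).symm
    rw [this, card_singleton]
  · intro j
    rw [show j + q - i = (j - i) + q by ring, dvd_add_self_right]

end

section

open Finset Real

/-- The distance from `R` to the point of angle `2πt` on the unit circle. -/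
noncomputable def chord (R t : ℝ) : ℝ := ‖(R : ℂ) - Complex.exp (2 * π * Complex.I * t)‖

theorem norm_exp_two_pi (t : ℝ) : ‖Complex.exp (2 * π * Complex.I * t)‖ = 1 := by
  have : (2 * π * Complex.I * t : ℂ) = ((2 * π * t : ℝ) : ℂ) * Complex.I := by push_cast; ring
  rw [this, Complex.norm_exp_ofReal_mul_I]

theorem chord_nonneg (R t : ℝ) : 0 ≤ chord R t := norm_nonneg _

theorem chord_sq (R t : ℝ) : chord R t ^ 2 = R ^ 2 - 2 * R * cos (2 * π * t) + 1 := by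
  have : (2 * π * Complex.I * t : ℂ) = ((2 * π * t : ℝ) : ℂ) * Complex.I := by push_cast; ring
  rw [chord, this, ← Complex.normSq_eq_norm_sq, Complex.normSq_apply, Complex.sub_re,
    Complex.sub_im, Complex.exp_ofReal_mul_I_re, Complex.exp_ofReal_mul_I_im, Complex.ofReal_re,
    Complex.ofReal_im]
  linear_combination sin_sq_add_cos_sq (2 * π * t)

theorem chord_one (t : ℝ) : chord 1 t = 2 * |sin (π * t)| := by
  rw [← abs_of_nonneg (chord_nonneg 1 t), ← abs_two, ← abs_mul, ← sq_eq_sq_iff_abs_eq_abs,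
    chord_sq, show 2 * π * t = 2 * (π * t) by ring, cos_two_mul, mul_pow, sin_sq]
  ring

theorem chord_one_neg (t : ℝ) : chord 1 (-t) = chord 1 t := by
  rw [chord_one, chord_one, mul_neg, sin_neg, abs_neg]

theorem chord_add_int (R t : ℝ) (n : ℤ) : chord R (t + n) = chord R t := by
  have : chord R (t + n) ^ 2 = chord R t ^ 2 := by
    rw [chord_sq, chord_sq, show 2 * π * (t + n) = 2 * π * t + n * (2 * π) by ring,
      cos_add_int_mul_two_pi]
  rwa [sq_eq_sq₀ (chord_nonneg _ _) (chord_nonneg _ _)] at this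

theorem chord_one_le_chord {R : ℝ} (hR : 1 ≤ R) (t : ℝ) : chord 1 t ≤ chord R t := by
  rw [← sq_le_sq₀ (chord_nonneg _ _) (chord_nonneg _ _), chord_sq, chord_sq]
  nlinarith [mul_nonneg (sub_nonneg.2 hR) (sub_nonneg.2 (cos_le_one (2 * π * t))),
    sq_nonneg (R - 1)]

theorem sub_one_le_chord (R t : ℝ) : R - 1 ≤ chord R t := by
  have := norm_sub_norm_le (R : ℂ) (Complex.exp (2 * π * Complex.I * t))
  rw [norm_exp_two_pi, Complex.norm_real] at this
  exact (sub_le_sub_right (le_abs_self R) 1).trans this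

theorem chord_le_sub_add {R : ℝ} (hR : 1 ≤ R) (t : ℝ) : chord R t ≤ R - 1 + chord 1 t := by
  have := norm_add_le ((R - 1 : ℝ) : ℂ) (((1 : ℝ) : ℂ) - Complex.exp (2 * π * Complex.I * t))
  rw [Complex.norm_real, norm_of_nonneg (sub_nonneg.2 hR)] at this
  refine le_trans (le_of_eq ?_) this
  rw [chord]
  congr 1
  push_cast
  ring

theorem chord_one_le_two (t : ℝ) : chord 1 t ≤ 2 := by
  rw [chord_one]
  linarith [abs_sin_le_one (π * t)]

theorem abs_chord_add_sub_le (R t h : ℝ) : |chord R (t + h) - chord R t| ≤ 2 * π * |h| := by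
  refine (abs_norm_sub_norm_le _ _).trans ?_
  have h1 : ((R : ℂ) - Complex.exp (2 * π * Complex.I * (t + h : ℝ)) -
      ((R : ℂ) - Complex.exp (2 * π * Complex.I * t))) =
      Complex.exp (2 * π * Complex.I * t) * (((1 : ℝ) : ℂ) - Complex.exp (2 * π * Complex.I * h)) := by
    push_cast
    rw [mul_add, Complex.exp_add]
    ring
  rw [h1, norm_mul, norm_exp_two_pi, one_mul]
  change chord 1 h ≤ _
  rw [chord_one]
  have := abs_sin_le_abs (x := π * h)
  rw [abs_mul, abs_of_pos pi_pos] at this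
  linarith

theorem four_mul_abs_le_chord {t : ℝ} (ht : |t| ≤ 1 / 2) : 4 * |t| ≤ chord 1 t := by
  have h : |π * t| ≤ π / 2 := by
    rw [abs_mul, abs_of_pos pi_pos]
    nlinarith [pi_pos]
  have := mul_abs_le_abs_sin h
  rw [abs_mul, abs_of_pos pi_pos, ← mul_assoc, div_mul_cancel₀ _ pi_ne_zero] at this
  rw [chord_one]
  linarith

theorem four_mul_abs_sub_round_le_chord (t : ℝ) : 4 * |t - round t| ≤ chord 1 t := by
  have h : chord 1 (t - round t) = chord 1 t := by
    rw [sub_eq_add_neg, ← Int.cast_neg, chord_add_int]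
  exact h ▸ four_mul_abs_le_chord (abs_sub_round t)

theorem prod_range_chord {q : ℕ} (hq : 0 < q) {p : ℤ} (hp : IsCoprime p (q : ℤ)) (R z : ℝ) :
    ∏ r ∈ range q, chord R (z + (r : ℕ) * (p / q)) =
      ‖(R : ℂ) ^ q - Complex.exp (2 * π * Complex.I * z) ^ q‖ := by
  have : NeZero q := ⟨hq.ne'⟩
  have hζ := Complex.isPrimitiveRoot_exp_of_isCoprime p q hq.ne' hp
  rw [hζ.pow_sub_pow_eq_prod_sub_mul _ _ hq, norm_prod]
  refine prod_nbij (fun r => Complex.exp (2 * π * Complex.I * (p / q)) ^ r) ?_ ?_ ?_ ?_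
  · intro r _
    rw [Polynomial.mem_nthRootsFinset hq, ← pow_mul, mul_comm r, pow_mul, hζ.pow_eq_one, one_pow]
  · intro r hr s hs h
    simp only [coe_range, Set.mem_Iio] at hr hs
    exact hζ.pow_inj hr hs h
  · intro x hx
    simp only [mem_coe] at hx
    rw [Polynomial.mem_nthRootsFinset hq] at hx
    obtain ⟨r, hr, h⟩ := hζ.eq_pow_of_pow_eq_one hx
    exact ⟨r, by simpa using hr, h⟩
  · intro r _
    rw [chord, ← Complex.exp_nat_mul, ← Complex.exp_add]
    congr 3
    push_cast
    ring

theorem prod_range_chord_le {q : ℕ} (hq : 0 < q) {p : ℤ} (hp : IsCoprime p (q : ℤ)) {R : ℝ}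
    (hR : 0 ≤ R) (z : ℝ) : ∏ r ∈ range q, chord R (z + (r : ℕ) * (p / q)) ≤ R ^ q + 1 := by
  rw [prod_range_chord hq hp]
  refine (norm_sub_le _ _).trans ?_
  rw [norm_pow, norm_pow, norm_exp_two_pi, Complex.norm_real, norm_of_nonneg hR, one_pow]

theorem le_prod_range_chord {q : ℕ} (hq : 0 < q) {p : ℤ} (hp : IsCoprime p (q : ℤ)) {R : ℝ}
    (hR : 0 ≤ R) (z : ℝ) : R ^ q - 1 ≤ ∏ r ∈ range q, chord R (z + (r : ℕ) * (p / q)) := by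
  rw [prod_range_chord hq hp]
  refine le_trans (le_of_eq ?_) (norm_sub_norm_le _ _)
  rw [norm_pow, norm_pow, norm_exp_two_pi, Complex.norm_real, norm_of_nonneg hR, one_pow]

/-- Few points of a rotated grid of mesh `1 / q` are close to the integers. -/
theorem card_chord_le {q : ℕ} (hq : 0 < q) {p : ℤ} (hp : IsCoprime p (q : ℤ)) (z σ : ℝ)
    (hσ : 0 ≤ σ) :
    (#{r ∈ range q | chord 1 (z + (r : ℕ) * (p / q)) ≤ σ} : ℝ) ≤ q * σ / 2 + 2 := by
  have hq' : (0 : ℝ) < q := by exact_mod_cast hq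
  set t : ℕ → ℝ := fun r => z + (r : ℕ) * (p / q) with ht
  set w : ℕ → ℝ := fun r => q * (t r - round (t r)) with hw
  set A : ℝ := q * σ / 4 with hA
  have hA0 : 0 ≤ A := by positivity
  have hcard : #{r ∈ range q | chord 1 (z + (r : ℕ) * (p / q)) ≤ σ} ≤ #(Icc ⌊-A⌋ ⌊A⌋) := by
    refine card_le_card_of_injOn (fun r => ⌊w r⌋) ?_ ?_
    · intro r hr
      simp only [coe_filter, Set.mem_ofPred_eq] at hr
      have h1 := (four_mul_abs_sub_round_le_chord (t r)).trans hr.2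
      have h2 : |w r| ≤ A := by
        rw [hw, hA]
        simp only
        rw [abs_mul, abs_of_pos hq']
        nlinarith
      rw [abs_le] at h2
      simp only [coe_Icc, Set.mem_Icc]
      exact ⟨Int.floor_mono h2.1, Int.floor_mono h2.2⟩
    · intro r hr s hs h
      simp only [coe_filter, Set.mem_ofPred_eq, mem_range] at hr hs
      have h1 : |w r - w s| < 1 := Int.abs_sub_lt_one_of_floor_eq_floor h
      have h2 : w r - w s = (((r : ℤ) - s) * p - q * (round (t r) - round (t s)) : ℤ) := by
        simp only [hw, ht]
        push_cast
        field_simp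
        ring
      rw [h2] at h1
      have h3 : ((r : ℤ) - s) * p - q * (round (t r) - round (t s)) = 0 := by
        rw [← Int.abs_lt_one_iff]
        exact_mod_cast h1
      have h4 : (q : ℤ) ∣ ((r : ℤ) - s) * p := ⟨_, sub_eq_zero.1 h3⟩
      have h5 : (q : ℤ) ∣ (r : ℤ) - s := hp.symm.dvd_of_dvd_mul_right h4
      have h6 := Int.eq_zero_of_abs_lt_dvd h5 (by rw [abs_lt]; omega)
      omega
  have h7 : (⌊A⌋ : ℝ) - ⌊-A⌋ + 1 ≤ 2 * A + 2 := by
    linarith [Int.floor_le A, Int.lt_floor_add_one (-A)]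
  have h8 : (#(Icc ⌊-A⌋ ⌊A⌋) : ℝ) = (⌊A⌋ : ℝ) - ⌊-A⌋ + 1 := by
    rw [Int.card_Icc, ← Int.cast_natCast (R := ℝ), Int.toNat_of_nonneg]
    · push_cast; ring
    · have : ⌊-A⌋ ≤ ⌊A⌋ := Int.floor_mono (by linarith)
      omega
  calc _ ≤ (#(Icc ⌊-A⌋ ⌊A⌋) : ℝ) := by exact_mod_cast hcard
    _ ≤ 2 * A + 2 := h8 ▸ h7
    _ = _ := by rw [hA]; ring

end

section

open Finset Real

theorem periodic_chord {q : ℕ} (hq : 0 < q) (p : ℤ) (R z : ℝ) :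
    Function.Periodic (fun j : ℤ => chord R (z + j * (p / q))) (q : ℤ) := by
  intro j
  have hq' : (q : ℝ) ≠ 0 := by positivity
  have : z + ((j + q : ℤ) : ℝ) * (p / q) = z + j * (p / q) + p := by
    push_cast
    field_simp
    ring
  simp only [this, chord_add_int]

theorem chord_perturb {q : ℕ} {p j : ℤ} {α : ℝ}
    (hδ : 2 * π * |j * (α - p / q)| ≤ 1 / q) (R z : ℝ) :
    |chord R (z + j * α) - chord R (z + j * (p / q))| ≤ 1 / q := by
  refine le_trans ?_ hδ
  have := abs_chord_add_sub_le R (z + j * (p / q)) (j * (α - p / q))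
  rwa [show z + j * (p / q) + j * (α - p / q) = z + j * α by ring] at this

/-- Upper bound for the product over all but one point of the two blocks. -/
theorem prod_erase_chord_le {q ℓ : ℕ} (hq : 2 ≤ q) (hℓ : 1 ≤ ℓ) {p : ℤ}
    (hp : IsCoprime p (q : ℤ)) {α : ℝ}
    (hδ : ∀ j ∈ I₁ q ∪ I₂ q ℓ, 2 * π * |j * (α - p / q)| ≤ 1 / q) (z : ℝ) {i : ℤ}
    (hi : i ∈ I₁ q ∪ I₂ q ℓ) :
    ∏ j ∈ (I₁ q ∪ I₂ q ℓ).erase i, chord 1 (z + j * α) ≤ 4 * exp (5 * √q) := by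
  set J := I₁ q ∪ I₂ q ℓ with hJ
  set s : ℝ := √q with hs
  have hs2 : s * s = q := mul_self_sqrt (by positivity)
  have hs0 : 0 < s := sqrt_pos.2 (by positivity)
  have hqq : 1 / (q : ℝ) = 1 / s * (1 / s) := by rw [← hs2]; field_simp
  set R : ℝ := 1 + 1 / s with hR
  have hR1 : 1 ≤ R := by rw [hR]; linarith [show 0 < 1 / s by positivity]
  have hRle : R ≤ exp (1 / s) := by rw [hR, add_comm]; exact add_one_le_exp _
  set P := ∏ r ∈ range q, chord R (z + (r : ℕ) * (p / q)) with hP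
  have hPle : P ≤ 2 * exp s := by
    refine (prod_range_chord_le (by omega) hp (by linarith) z).trans ?_
    have h1 : R ^ q ≤ exp s := by
      calc R ^ q ≤ exp (1 / s) ^ q := by gcongr
        _ = exp s := by rw [← exp_nat_mul, ← hs2]; congr 1; field_simp
    linarith [one_le_exp hs0.le]
  clear_value s
  have hP0 : 0 ≤ P := prod_nonneg fun _ _ => chord_nonneg _ _
  have hterm : ∀ j ∈ J, chord 1 (z + j * α) ≤ exp (1 / s) * chord R (z + j * (p / q)) := by
    intro j hj
    have h1 := (abs_le.1 (chord_perturb (hδ j hj) 1 z)).2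
    have h2 := chord_one_le_chord hR1 (z + j * (p / q))
    have h3 := sub_one_le_chord R (z + j * (p / q))
    have h4 : 1 / (q : ℝ) ≤ 1 / s * chord R (z + j * (p / q)) := by
      rw [hqq]
      gcongr
      linarith
    calc _ ≤ R * chord R (z + j * (p / q)) := by
          rw [hR] at *
          linarith
      _ ≤ _ := mul_le_mul_of_nonneg_right hRle (chord_nonneg _ _)
  have hall : ∏ j ∈ J, chord R (z + j * (p / q)) = P * P := by
    have := prod_blocks_of_periodic hq hℓ (periodic_chord (by omega) p R z)
    simpa using this
  have herase : ∏ j ∈ J.erase i, chord R (z + j * (p / q)) ≤ 4 * exp (2 * s) * s := by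
    have h1 := mul_prod_erase J (fun j : ℤ => chord R (z + j * (p / q))) hi
    have h2 := sub_one_le_chord R (z + i * (p / q))
    have h3 : P * P ≤ (2 * exp s) * (2 * exp s) := mul_self_le_mul_self hP0 hPle
    have h4 : exp (2 * s) = exp s * exp s := by rw [← exp_add]; ring_nf
    have h5 : 0 ≤ ∏ j ∈ J.erase i, chord R (z + j * (p / q)) :=
      prod_nonneg fun _ _ => chord_nonneg _ _
    have h6 : 1 / s * ∏ j ∈ J.erase i, chord R (z + j * (p / q)) ≤ 4 * exp (2 * s) := by
      calc _ ≤ chord R (z + i * (p / q)) * ∏ j ∈ J.erase i, chord R (z + j * (p / q)) :=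
            mul_le_mul_of_nonneg_right (by linarith) h5
        _ = P * P := by rw [← hall]; exact h1
        _ ≤ _ := by rw [h4]; linarith
    rw [one_div, inv_mul_le_iff₀ hs0] at h6
    linarith
  calc ∏ j ∈ J.erase i, chord 1 (z + j * α)
      ≤ ∏ j ∈ J.erase i, exp (1 / s) * chord R (z + j * (p / q)) :=
        prod_le_prod (fun _ _ => chord_nonneg _ _) fun j hj => hterm j (mem_of_mem_erase hj)
    _ = exp (1 / s) ^ #(J.erase i) * ∏ j ∈ J.erase i, chord R (z + j * (p / q)) := by
        rw [prod_mul_distrib, prod_const]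
    _ ≤ exp (1 / s) ^ (2 * q) * (4 * exp (2 * s) * s) := by
        have : #(J.erase i) ≤ 2 * q := (card_blocks hq hℓ) ▸ card_le_card (erase_subset _ _)
        have h1 : 1 ≤ exp (1 / s) := one_le_exp (by positivity)
        gcongr
        exact prod_nonneg fun _ _ => chord_nonneg _ _
    _ ≤ exp (2 * s) * (4 * exp (2 * s) * exp s) := by
        have h1 : exp (1 / s) ^ (2 * q) = exp (2 * s) := by
          rw [← exp_nat_mul]
          push_cast
          rw [← hs2]
          congr 1
          field_simp
        rw [h1]
        gcongr
        linarith [add_one_le_exp s]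
    _ = 4 * exp (5 * s) := by
        rw [show 5 * s = 2 * s + 2 * s + s by ring, exp_add, exp_add]
        ring

/-- Lower bound for the product over all but at most two points of the two blocks, given a lower
bound for the individual factors. -/
theorem le_prod_chord {q ℓ : ℕ} (hq : 2 ≤ q) (hℓ : 1 ≤ ℓ) {p : ℤ}
    (hp : IsCoprime p (q : ℤ)) {α : ℝ}
    (hδ : ∀ j ∈ I₁ q ∪ I₂ q ℓ, 2 * π * |j * (α - p / q)| ≤ 1 / q) (z : ℝ) {S : Finset ℤ}
    (hS : S ⊆ I₁ q ∪ I₂ q ℓ) (hS2 : #((I₁ q ∪ I₂ q ℓ) \ S) ≤ 2) {b : ℝ} (hb0 : 0 < b)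
    (hb1 : b ≤ 1) (hb : ∀ j ∈ S, b ≤ chord 1 (z + j * α)) :
    exp (-(4 * √q)) * (b / 3) ^ (2 * √q + 6) ≤ ∏ j ∈ S, chord 1 (z + j * α) := by
  set J := I₁ q ∪ I₂ q ℓ with hJ
  set s : ℝ := √q with hs
  have hs2 : s * s = q := mul_self_sqrt (by positivity)
  have hs0 : 0 < s := sqrt_pos.2 (by positivity)
  have hqq : 1 / (q : ℝ) = 1 / s * (1 / s) := by rw [← hs2]; field_simp
  have hq' : (2 : ℝ) ≤ q := by exact_mod_cast hq
  have hs1 : 1 ≤ s := by nlinarith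
  have hqs : 1 / (q : ℝ) ≤ 1 / s := by
    apply one_div_le_one_div_of_le hs0
    nlinarith
  set R : ℝ := 1 + 1 / q with hR
  have hR1 : 1 ≤ R := by rw [hR]; linarith [show 0 < 1 / (q : ℝ) by positivity]
  have hR2 : R ≤ 2 := by
    have : 1 / (q : ℝ) ≤ 1 := by rw [div_le_one (by linarith)]; linarith
    rw [hR]; linarith
  set P := ∏ r ∈ range q, chord R (z + (r : ℕ) * (p / q)) with hP
  have hP1 : 1 ≤ P := by
    refine le_trans ?_ (le_prod_range_chord (by omega) hp (by linarith) z)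
    have := one_add_mul_le_pow (a := 1 / (q : ℝ))
      (by linarith [show 0 < 1 / (q : ℝ) by positivity]) q
    rw [mul_one_div_cancel (by linarith)] at this
    linarith
  have hall : ∏ j ∈ J, chord R (z + j * (p / q)) = P * P := by
    have := prod_blocks_of_periodic hq hℓ (periodic_chord (by omega) p R z)
    simpa using this
  set T := S.filter (fun j : ℤ => 1 / s ≤ chord 1 (z + j * α)) with hT
  have hTS : T ⊆ S := filter_subset _ _
  have hTJ : T ⊆ J := hTS.trans hS
  have hterm : ∀ j ∈ T, exp (-(2 / s)) * chord R (z + j * (p / q)) ≤ chord 1 (z + j * α) := by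
    intro j hj
    have h1 := (abs_le.1 (chord_perturb (hδ j (hTJ hj)) 1 z)).1
    have h2 := chord_le_sub_add hR1 (z + j * (p / q))
    have h3 : 1 / s ≤ chord 1 (z + j * α) := (mem_filter.1 hj).2
    have h4 : 1 / (q : ℝ) ≤ 1 / s * chord 1 (z + j * α) := by
      rw [hqq]
      gcongr
    have h5 : chord R (z + j * (p / q)) ≤ (2 / s + 1) * chord 1 (z + j * α) := by
      rw [hR] at h2 ⊢
      have : 2 / s = 2 * (1 / s) := by ring
      rw [this]
      linarith
    rw [exp_neg, inv_mul_le_iff₀ (exp_pos _)]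
    exact h5.trans (mul_le_mul_of_nonneg_right (add_one_le_exp _) (chord_nonneg _ _))
  have hcard : (#(J \ T) : ℝ) ≤ 2 * s + 6 := by
    have h1 : J \ T ⊆ (J \ S) ∪ J.filter (fun j : ℤ => chord 1 (z + j * (p / q)) ≤ 2 / s) := by
      intro j hj
      rw [mem_sdiff] at hj
      by_cases hjS : j ∈ S
      · refine mem_union_right _ (mem_filter.2 ⟨hj.1, ?_⟩)
        have h2 : chord 1 (z + j * α) < 1 / s := by
          by_contra h
          exact hj.2 (mem_filter.2 ⟨hjS, not_lt.1 h⟩)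
        have h3 := (abs_le.1 (chord_perturb (hδ j hj.1) 1 z)).1
        have : 2 / s = 2 * (1 / s) := by ring
        linarith
      · exact mem_union_left _ (mem_sdiff.2 ⟨hj.1, hjS⟩)
    have h2 := card_filter_blocks hq hℓ (fun j : ℤ => chord 1 (z + j * (p / q)) ≤ 2 / s)
      (fun j => by rw [show chord 1 (z + ((j + q : ℤ) : ℝ) * (p / q)) = chord 1 (z + j * (p / q))
        from periodic_chord (by omega) p 1 z j])
    have h3 := card_chord_le (q := q) (by omega) hp z (2 / s) (by positivity)
    have h4 : #(J \ T) ≤ 2 + 2 * #{r ∈ range q | chord 1 (z + (r : ℕ) * (p / q)) ≤ 2 / s} := by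
      refine (card_le_card h1).trans ((card_union_le _ _).trans ?_)
      rw [hJ, h2]
      simpa using hS2
    have h5 : (#(J \ T) : ℝ) ≤
        2 + 2 * (#{r ∈ range q | chord 1 (z + (r : ℕ) * (p / q)) ≤ 2 / s} : ℝ) := by
      exact_mod_cast h4
    have h6 : (q : ℝ) * (2 / s) / 2 = s := by rw [← hs2]; field_simp
    rw [h6] at h3
    linarith
  have hfar : 1 ≤ (3 : ℝ) ^ #(J \ T) * ∏ j ∈ T, chord R (z + j * (p / q)) := by
    calc (1 : ℝ) ≤ P * P := by nlinarith
      _ = (∏ j ∈ J \ T, chord R (z + j * (p / q))) * ∏ j ∈ T, chord R (z + j * (p / q)) := by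
          rw [← hall, prod_sdiff hTJ]
      _ ≤ _ := by
          rw [← prod_const]
          refine mul_le_mul_of_nonneg_right (prod_le_prod (fun _ _ => chord_nonneg _ _) ?_)
            (prod_nonneg fun _ _ => chord_nonneg _ _)
          intro j _
          linarith [chord_le_sub_add hR1 (z + j * (p / q)), chord_one_le_two (z + j * (p / q))]
  have hexp : exp (-(4 * s)) ≤ exp (-(2 / s)) ^ #T := by
    have h1 : #T ≤ 2 * q := (card_blocks hq hℓ) ▸ card_le_card hTJ
    rw [← exp_nat_mul]
    apply exp_le_exp.2
    have h2 : (#T : ℝ) ≤ 2 * (s * s) := by rw [hs2]; exact_mod_cast h1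
    have h3 : (#T : ℝ) * (2 / s) ≤ 2 * (s * s) * (2 / s) := by gcongr
    have h4 : 2 * (s * s) * (2 / s) = 4 * s := by field_simp; norm_num
    linarith
  have hnear : b ^ #(J \ T) ≤ ∏ j ∈ S \ T, chord 1 (z + j * α) := by
    calc b ^ #(J \ T) ≤ b ^ #(S \ T) :=
          pow_le_pow_of_le_one hb0.le hb1 (card_le_card (sdiff_subset_sdiff hS subset_rfl))
      _ = ∏ _j ∈ S \ T, b := (prod_const b).symm
      _ ≤ _ := prod_le_prod (fun _ _ => hb0.le) fun j hj => hb j (mem_sdiff.1 hj).1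
  have hTprod : exp (-(4 * s)) * (1 / 3) ^ #(J \ T) ≤ ∏ j ∈ T, chord 1 (z + j * α) := by
    calc exp (-(4 * s)) * (1 / 3) ^ #(J \ T)
        ≤ exp (-(2 / s)) ^ #T * ∏ j ∈ T, chord R (z + j * (p / q)) := by
          gcongr
          rw [one_div, inv_pow]
          exact (inv_le_iff_one_le_mul₀' (by positivity)).2 hfar
      _ = ∏ j ∈ T, exp (-(2 / s)) * chord R (z + j * (p / q)) := by
          rw [prod_mul_distrib, prod_const]
      _ ≤ _ := prod_le_prod (fun _ _ => mul_nonneg (exp_pos _).le (chord_nonneg _ _)) hterm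
  calc exp (-(4 * s)) * (b / 3) ^ (2 * s + 6)
      ≤ exp (-(4 * s)) * (b / 3) ^ #(J \ T) := by
        gcongr
        rw [← rpow_natCast]
        exact rpow_le_rpow_of_exponent_ge (by positivity) (by linarith) hcard
    _ = b ^ #(J \ T) * (exp (-(4 * s)) * (1 / 3) ^ #(J \ T)) := by
        rw [div_eq_mul_one_div, mul_pow]
        ring
    _ ≤ (∏ j ∈ S \ T, chord 1 (z + j * α)) * ∏ j ∈ T, chord 1 (z + j * α) := by
        gcongr
        exact prod_nonneg fun _ _ => chord_nonneg _ _
    _ = _ := prod_sdiff hTS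

end

section

open Finset Real

theorem abs_cos_sub_cos (a b : ℝ) :
    |cos (2 * π * a) - cos (2 * π * b)| = chord 1 (a + b) * chord 1 (a - b) / 2 := by
  rw [Real.cos_sub_cos, chord_one, chord_one, abs_mul, abs_mul, abs_neg, abs_two,
    show (2 * π * a + 2 * π * b) / 2 = π * (a + b) by ring,
    show (2 * π * a - 2 * π * b) / 2 = π * (a - b) by ring]
  ring

/-- A nonresonant phase satisfies a Diophantine condition of order two. -/
theorem exists_le_chord_of_notMem_R {α θ : ℝ} (hθ : θ ∉ R α) :
    ∃ c : ℝ, 0 < c ∧ ∀ k : ℤ, c / (1 + k ^ 2) ≤ chord 1 (2 * θ + k * α) := by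
  rw [R, Set.mem_union, not_or] at hθ
  obtain ⟨h1, h2⟩ := hθ
  have hfin : {k : ℤ | |sin (π * (2 * θ + k * α))| ≤ ((k : ℝ) ^ 2)⁻¹}.Finite :=
    Set.not_infinite.1 h1
  set A : Finset ℤ := insert 0 hfin.toFinset with hA
  set g : ℤ → ℝ := fun k => chord 1 (2 * θ + k * α) * (1 + k ^ 2) with hg
  have hgpos : ∀ k, 0 < g k := by
    intro k
    refine mul_pos ((chord_nonneg _ _).lt_of_ne' fun h0 => h2 ?_) (by positivity)
    have h3 := four_mul_abs_sub_round_le_chord (2 * θ + k * α)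
    rw [h0] at h3
    have h4 : 2 * θ + k * α - round (2 * θ + k * α) = 0 := by
      rw [← abs_eq_zero]
      linarith [abs_nonneg (2 * θ + k * α - round (2 * θ + k * α))]
    exact ⟨k, round (2 * θ + k * α), sub_eq_zero.1 h4⟩
  obtain ⟨k₀, -, hk₀⟩ := A.exists_min_image g ⟨0, mem_insert_self _ _⟩
  refine ⟨min (g k₀) 1, lt_min (hgpos k₀) one_pos, fun k => ?_⟩
  rw [div_le_iff₀ (by positivity)]
  by_cases hk : k ∈ A
  · exact (min_le_left _ _).trans (hk₀ k hk)
  · refine (min_le_right _ _).trans ?_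
    simp only [hA, mem_insert, Set.Finite.mem_toFinset, Set.mem_ofPred_eq, not_or, not_le] at hk
    have hk2 : (0 : ℝ) < (k : ℝ) ^ 2 := by
      have : (k : ℝ) ≠ 0 := by exact_mod_cast hk.1
      positivity
    have h3 := hk.2
    rw [inv_lt_iff_one_lt_mul₀ hk2] at h3
    rw [chord_one]
    nlinarith [abs_nonneg (sin (π * (2 * θ + k * α)))]

theorem exists_decomp_of_mem_blocks {q ℓ : ℕ} (hq : 2 ≤ q) (hℓ : 1 ≤ ℓ) {j : ℤ}
    (hj : j ∈ I₁ q ∪ I₂ q ℓ) : ∃ k c : ℤ, j = k + c * q ∧ |k| ≤ 2 * q ∧ |c| ≤ ℓ := by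
  simp only [mem_union, I₁, I₂, mem_Icc] at hj
  rcases hj with hj | hj
  · exact ⟨j, 0, by simp, by rw [abs_le]; omega, by simp⟩
  · refine ⟨j - ((ℓ : ℤ) - 1) * q, (ℓ : ℤ) - 1, by ring, ?_, by rw [abs_le]; omega⟩
    have : ((ℓ : ℤ) + 1) * q = ((ℓ : ℤ) - 1) * q + 2 * q := by ring
    rw [abs_le]
    omega

theorem abs_le_of_mem_blocks {q ℓ : ℕ} (hq : 2 ≤ q) (hℓ : 1 ≤ ℓ) {j : ℤ}
    (hj : j ∈ I₁ q ∪ I₂ q ℓ) : |(j : ℝ)| ≤ 2 * (ℓ * q) := by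
  have hlq : (q : ℤ) ≤ (ℓ : ℤ) * q := le_mul_of_one_le_left (by positivity) (by exact_mod_cast hℓ)
  have : |j| ≤ 2 * ((ℓ : ℤ) * q) := by
    simp only [mem_union, I₁, I₂, mem_Icc, add_mul, sub_mul] at hj
    rw [abs_le]
    omega
  exact_mod_cast this

/-- The data of one scale: `p / q` approximates `α` to order `1 / (q * u ^ 9)`, where `u ^ 9` stands
for the next denominator, and the two blocks lie at distance `ℓ * q ≤ u ^ 8`. -/
structure Scale (α : ℝ) (q ℓ : ℕ) (p : ℤ) (u : ℝ) : Prop where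
  two_le : 2 ≤ q
  one_le : 1 ≤ ℓ
  coprime : IsCoprime p (q : ℤ)
  le_u : 16 ≤ u
  length_le : ℓ * q ≤ u ^ 8
  abs_le : |q * α - p| ≤ 1 / u ^ 9
  le_abs : 1 / (2 * u ^ 9) ≤ |q * α - p|

namespace Scale

variable {α : ℝ} {q ℓ : ℕ} {p : ℤ} {u : ℝ}

theorem q_pos (h : Scale α q ℓ p u) : (0 : ℝ) < q := by
  have := h.two_le
  positivity

theorem u_pos (h : Scale α q ℓ p u) : 0 < u := by linarith [h.le_u]

theorem length_mul_abs_le (h : Scale α q ℓ p u) : ℓ * |q * α - p| ≤ 1 / (q * u) := by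
  have hq := h.q_pos
  have hu := h.u_pos
  calc ℓ * |q * α - p| ≤ (u ^ 8 / q) * (1 / u ^ 9) := by
        gcongr
        · rw [le_div_iff₀ hq]; exact h.length_le
        · exact h.abs_le
    _ = _ := by field_simp

theorem perturb (h : Scale α q ℓ p u) (j : ℤ) (hj : j ∈ I₁ q ∪ I₂ q ℓ) :
    2 * π * |j * (α - p / q)| ≤ 1 / q := by
  have hq := h.q_pos
  have hu := h.u_pos
  have h1 : |(j : ℝ) * (α - p / q)| = |(j : ℝ)| * |q * α - p| / q := by
    rw [abs_mul, show α - p / q = (q * α - p) / q by field_simp, abs_div, abs_of_pos hq]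
    ring
  have h2 : |(j : ℝ)| * |q * α - p| ≤ 2 * q * (1 / (q * u)) := by
    calc _ ≤ 2 * (ℓ * q) * |q * α - p| := by
          gcongr
          exact abs_le_of_mem_blocks h.two_le h.one_le hj
      _ = 2 * q * (ℓ * |q * α - p|) := by ring
      _ ≤ _ := by gcongr; exact h.length_mul_abs_le
  have h3 : 2 * q * (1 / (q * u)) = 2 / u := by field_simp
  have h4 : 2 / u ≤ 1 / 8 := by
    rw [div_le_div_iff₀ hu (by norm_num)]
    linarith [h.le_u]
  have h5 : 2 * π * (|(j : ℝ)| * |q * α - p|) ≤ 1 := by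
    have := pi_le_four
    have := pi_pos
    nlinarith [mul_nonneg (abs_nonneg (j : ℝ)) (abs_nonneg (q * α - p))]
  rw [h1, ← mul_div_assoc]
  gcongr

/-- Lower bound for the sums of two phases. -/
theorem le_chord_add (h : Scale α q ℓ p u) {θ c : ℝ} (hc : 0 < c)
    (hθ : ∀ k : ℤ, c / (1 + k ^ 2) ≤ chord 1 (2 * θ + k * α)) (hqc : 1000 ≤ q * c)
    {i j : ℤ} (hi : i ∈ I₁ q ∪ I₂ q ℓ) (hj : j ∈ I₁ q ∪ I₂ q ℓ) :
    1 / (q : ℝ) ^ 33 ≤ chord 1 (2 * θ + i * α + j * α) := by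
  have hq := h.q_pos
  have hu := h.u_pos
  have hq1 : (1 : ℝ) ≤ q := by exact_mod_cast (by linarith [h.two_le] : 1 ≤ q)
  by_cases hcase : (q : ℝ) ^ 2 ≤ u
  · obtain ⟨k, m, rfl, hk, hm⟩ := exists_decomp_of_mem_blocks h.two_le h.one_le hi
    obtain ⟨k', m', rfl, hk', hm'⟩ := exists_decomp_of_mem_blocks h.two_le h.one_le hj
    have hK : |((k + k' : ℤ) : ℝ)| ≤ 4 * q := by
      have : |k + k'| ≤ 4 * (q : ℤ) := (abs_add_le k k').trans (by linarith)
      exact_mod_cast this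
    have hM : |((m + m' : ℤ) : ℝ)| ≤ 2 * ℓ := by
      have : |m + m'| ≤ 2 * (ℓ : ℤ) := (abs_add_le m m').trans (by linarith)
      exact_mod_cast this
    have h1 : 2 * θ + (k + m * q : ℤ) * α + (k' + m' * q : ℤ) * α =
        2 * θ + (k + k' : ℤ) * α + (m + m' : ℤ) * (q * α - p) + ((m + m') * p : ℤ) := by
      push_cast; ring
    rw [h1, chord_add_int]
    have h2 := (_root_.abs_le.1 (abs_chord_add_sub_le 1 (2 * θ + (k + k' : ℤ) * α)
      ((m + m' : ℤ) * (q * α - p)))).1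
    have h3 : c / (17 * q ^ 2) ≤ chord 1 (2 * θ + (k + k' : ℤ) * α) := by
      refine le_trans ?_ (hθ _)
      have : ((k + k' : ℤ) : ℝ) ^ 2 ≤ (4 * q) ^ 2 := sq_le_sq' (by linarith [(_root_.abs_le.1 hK).1])
        (_root_.abs_le.1 hK).2
      gcongr
      nlinarith
    have h4 : |((m + m' : ℤ) : ℝ) * (q * α - p)| ≤ 2 / q ^ 3 := by
      rw [abs_mul]
      calc _ ≤ 2 * ℓ * |q * α - p| := by gcongr
        _ = 2 * (ℓ * |q * α - p|) := by ring
        _ ≤ 2 * (1 / (q * u)) := by gcongr; exact h.length_mul_abs_le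
        _ ≤ 2 * (1 / (q * q ^ 2)) := by gcongr
        _ = _ := by ring
    have h5 : 2 * π * |((m + m' : ℤ) : ℝ) * (q * α - p)| ≤ 16 / q ^ 3 := by
      have := pi_le_four
      have h6 : 16 / (q : ℝ) ^ 3 = 8 * (2 / q ^ 3) := by ring
      rw [h6]
      have := pi_pos
      exact mul_le_mul (by linarith) h4 (abs_nonneg _) (by norm_num)
    have h6 : 17 / (q : ℝ) ^ 3 ≤ c / (17 * q ^ 2) := by
      rw [div_le_div_iff₀ (by positivity) (by positivity)]
      nlinarith [sq_nonneg (q : ℝ)]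
    have h7 : 1 / (q : ℝ) ^ 33 ≤ 1 / q ^ 3 := by
      gcongr
      norm_num
    have h8 : 17 / (q : ℝ) ^ 3 = 16 / q ^ 3 + 1 / q ^ 3 := by ring
    linarith
  · push Not at hcase
    have h1 : 2 * θ + i * α + j * α = 2 * θ + (i + j : ℤ) * α := by push_cast; ring
    rw [h1]
    refine le_trans ?_ (hθ _)
    have h2 : |((i + j : ℤ) : ℝ)| ≤ 4 * q ^ 16 := by
      push_cast
      calc _ ≤ |(i : ℝ)| + |(j : ℝ)| := abs_add_le _ _
        _ ≤ 2 * (ℓ * q) + 2 * (ℓ * q) := add_le_add (abs_le_of_mem_blocks h.two_le h.one_le hi)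
            (abs_le_of_mem_blocks h.two_le h.one_le hj)
        _ ≤ 2 * u ^ 8 + 2 * u ^ 8 := by linarith [h.length_le]
        _ ≤ 2 * (q ^ 2) ^ 8 + 2 * (q ^ 2) ^ 8 := by gcongr
        _ = _ := by ring
    have h3 : ((i + j : ℤ) : ℝ) ^ 2 ≤ (4 * q ^ 16) ^ 2 :=
      sq_le_sq' (by linarith [(_root_.abs_le.1 h2).1]) (_root_.abs_le.1 h2).2
    have h4 : (1 : ℝ) ≤ q ^ 32 := one_le_pow₀ hq1
    have h5 : 1 + ((i + j : ℤ) : ℝ) ^ 2 ≤ 17 * q ^ 32 := by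
      calc _ ≤ (q : ℝ) ^ 32 + (4 * q ^ 16) ^ 2 := by linarith
        _ = _ := by ring
    rw [div_le_div_iff₀ (by positivity) (by positivity), one_mul]
    refine h5.trans ?_
    rw [show c * (q : ℝ) ^ 33 = (q * c) * q ^ 32 by ring]
    gcongr
    linarith

theorem le_chord_sub_of_not_dvd (h : Scale α q ℓ p u) {i j : ℤ} (hi : i ∈ I₁ q ∪ I₂ q ℓ)
    (hj : j ∈ I₁ q ∪ I₂ q ℓ) (hij : ¬(q : ℤ) ∣ j - i) :
    1 / (q : ℝ) ^ 33 ≤ chord 1 (-(i * α) + j * α) := by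
  have hq := h.q_pos
  have hq1 : (1 : ℝ) ≤ q := by exact_mod_cast (by linarith [h.two_le] : 1 ≤ q)
  set t : ℝ := (j - i : ℤ) * (p / q) with ht
  have h1 : -(i * α) + j * α = t + (j * (α - p / q) - i * (α - p / q)) := by
    rw [ht]; push_cast; ring
  have h2 := (_root_.abs_le.1 (abs_chord_add_sub_le 1 t (j * (α - p / q) - i * (α - p / q)))).1
  have h3 : 2 * π * |j * (α - p / q) - i * (α - p / q)| ≤ 2 * (1 / q) := by
    calc _ ≤ 2 * π * (|j * (α - p / q)| + |i * (α - p / q)|) := by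
          have := pi_pos
          gcongr
          exact abs_sub _ _
      _ ≤ _ := by linarith [h.perturb i hi, h.perturb j hj]
  have h4 : 1 / (q : ℝ) ≤ |t - round t| := by
    have h5 : t - round t = ((j - i) * p - q * round t : ℤ) / (q : ℝ) := by
      rw [eq_div_iff hq.ne', sub_mul, ht]
      push_cast
      field_simp
    rw [h5, abs_div, abs_of_pos hq]
    gcongr
    have h6 : (j - i) * p - q * round t ≠ 0 := fun h0 =>
      hij (h.coprime.symm.dvd_of_dvd_mul_right ⟨_, sub_eq_zero.1 h0⟩)
    exact_mod_cast Int.one_le_abs h6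
  have h5 := four_mul_abs_sub_round_le_chord t
  have h7 : 1 / (q : ℝ) ^ 33 ≤ 1 / q := by
    gcongr
    exact le_self_pow₀ hq1 (by norm_num)
  rw [h1]
  have : 0 < 1 / (q : ℝ) := by positivity
  linarith

theorem le_chord_sub (h : Scale α q ℓ p u) {i j : ℤ} (hi : i ∈ I₁ q ∪ I₂ q ℓ)
    (hj : j ∈ I₁ q ∪ I₂ q ℓ) (hij : j ≠ i) (hd : (q : ℤ) ∣ j - i) :
    1 / u ^ 9 ≤ chord 1 (-(i * α) + j * α) := by
  have hq := h.q_pos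
  have hu := h.u_pos
  obtain ⟨c, hc⟩ := hd
  have hc0 : c ≠ 0 := by
    rintro rfl
    exact hij (by linarith)
  have hc1 : (1 : ℝ) ≤ |(c : ℝ)| := by exact_mod_cast Int.one_le_abs hc0
  have hcR : (j : ℝ) - i = q * c := by exact_mod_cast hc
  have h1 : -(i * α) + j * α = c * (q * α - p) + (c * p : ℤ) := by
    rw [show -(i * α) + j * α = ((j : ℝ) - i) * α by ring, hcR]
    push_cast
    ring
  have h2 : |(c : ℝ)| ≤ 4 * ℓ := by
    have h3 : q * |(c : ℝ)| ≤ q * (4 * ℓ) := by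
      rw [← abs_of_pos hq, ← abs_mul, ← hcR, abs_of_pos hq]
      refine (abs_sub _ _).trans ?_
      linarith [abs_le_of_mem_blocks h.two_le h.one_le hi,
        abs_le_of_mem_blocks h.two_le h.one_le hj]
    exact le_of_mul_le_mul_left h3 hq
  have h3 : |(c : ℝ) * (q * α - p)| ≤ 1 / 2 := by
    rw [abs_mul]
    calc _ ≤ 4 * ℓ * |q * α - p| := by gcongr
      _ = 4 * (ℓ * |q * α - p|) := by ring
      _ ≤ 4 * (1 / (q * u)) := by gcongr; exact h.length_mul_abs_le
      _ ≤ 4 * (1 / (1 * 16)) := by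
        have := h.le_u
        have : (1 : ℝ) ≤ q := by exact_mod_cast (by linarith [h.two_le] : 1 ≤ q)
        gcongr
      _ ≤ _ := by norm_num
  rw [h1, chord_add_int]
  refine le_trans ?_ (four_mul_abs_le_chord h3)
  rw [abs_mul]
  have h4 := h.le_abs
  have h5 : 1 / (2 * u ^ 9) = 1 / u ^ 9 / 2 := by ring
  have h6 : 0 < 1 / u ^ 9 := by positivity
  nlinarith

/-- The product over the differences of phases; the point congruent to `i` accounts for the factor
`1 / u ^ 9`. -/
theorem le_prod_chord_sub (h : Scale α q ℓ p u) {i : ℤ} (hi : i ∈ I₁ q ∪ I₂ q ℓ) :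
    exp (-(4 * √q)) * (1 / (q : ℝ) ^ 33 / 3) ^ (2 * √q + 6) * (1 / u ^ 9) ≤
      ∏ j ∈ (I₁ q ∪ I₂ q ℓ).erase i, chord 1 (-(i * α) + j * α) := by
  have hq := h.q_pos
  have hu := h.u_pos
  have hq1 : (1 : ℝ) ≤ q := by exact_mod_cast (by linarith [h.two_le] : 1 ≤ q)
  set J := I₁ q ∪ I₂ q ℓ with hJ
  set S := J.filter (fun j => ¬(q : ℤ) ∣ j - i) with hS
  have hSJ : S ⊆ J := filter_subset _ _
  have hcompl : J \ S = {j ∈ J | (q : ℤ) ∣ j - i} := by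
    ext j
    simp only [hS, Finset.mem_sdiff, mem_filter]
    tauto
  have hcard : #(J \ S) = 2 := by rw [hcompl]; exact card_blocks_filter_dvd h.two_le h.one_le i
  have hiS : i ∈ J \ S := by rw [hcompl]; exact mem_filter.2 ⟨hi, by simp⟩
  have hSe : S ⊆ J.erase i := fun j hj => by
    refine mem_erase.2 ⟨?_, hSJ hj⟩
    rintro rfl
    exact (mem_sdiff.1 hiS).2 hj
  have hrest : J.erase i \ S = (J \ S).erase i := erase_sdiff_comm _ _ _
  obtain ⟨i', hi'⟩ : ∃ i', (J \ S).erase i = {i'} :=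
    card_eq_one.1 (by rw [card_erase_of_mem hiS, hcard])
  have hmem : i' ∈ (J \ S).erase i := by rw [hi']; exact mem_singleton_self _
  rw [mem_erase, hcompl, mem_filter] at hmem
  have hlow := h.le_chord_sub hi hmem.2.1 hmem.1 hmem.2.2
  have hmain := le_prod_chord h.two_le h.one_le h.coprime h.perturb (-(i * α)) hSJ hcard.le
    (b := 1 / (q : ℝ) ^ 33) (by positivity)
    (by rw [div_le_one (by positivity)]; exact one_le_pow₀ hq1)
    (fun j hj => h.le_chord_sub_of_not_dvd hi (hSJ hj) (mem_filter.1 hj).2)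
  rw [← prod_sdiff hSe, hrest, hi', prod_singleton, mul_comm]
  gcongr
  exact chord_nonneg _ _

theorem le_prod_chord_add (h : Scale α q ℓ p u) {θ c : ℝ} (hc : 0 < c)
    (hθ : ∀ k : ℤ, c / (1 + k ^ 2) ≤ chord 1 (2 * θ + k * α)) (hqc : 1000 ≤ q * c)
    {i : ℤ} (hi : i ∈ I₁ q ∪ I₂ q ℓ) :
    exp (-(4 * √q)) * (1 / (q : ℝ) ^ 33 / 3) ^ (2 * √q + 6) ≤
      ∏ j ∈ (I₁ q ∪ I₂ q ℓ).erase i, chord 1 (2 * θ + i * α + j * α) := by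
  have hq := h.q_pos
  have hq1 : (1 : ℝ) ≤ q := by exact_mod_cast (by linarith [h.two_le] : 1 ≤ q)
  refine le_prod_chord h.two_le h.one_le h.coprime h.perturb _ (erase_subset _ _) ?_
    (by positivity) (by rw [div_le_one (by positivity)]; exact one_le_pow₀ hq1)
    fun j hj => h.le_chord_add hc hθ hqc hi (mem_of_mem_erase hj)
  rw [sdiff_erase_self hi, card_singleton]
  norm_num

end Scale

end

section

open Finset Real Filter Topology Asymptotics

theorem Scale.cos_ne_cos {α : ℝ} {q ℓ : ℕ} {p : ℤ} {u : ℝ} (h : Scale α q ℓ p u) {θ c : ℝ}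
    (hc : 0 < c) (hθ : ∀ k : ℤ, c / (1 + k ^ 2) ≤ chord 1 (2 * θ + k * α)) (hqc : 1000 ≤ q * c)
    {i j : ℤ} (hi : i ∈ I₁ q ∪ I₂ q ℓ) (hj : j ∈ I₁ q ∪ I₂ q ℓ) (hij : j ≠ i) :
    cos (2 * π * (θ + i * α)) ≠ cos (2 * π * (θ + j * α)) := by
  have hq := h.q_pos
  have hu := h.u_pos
  have h1 : 0 < chord 1 (2 * θ + i * α + j * α) :=
    lt_of_lt_of_le (by positivity) (h.le_chord_add hc hθ hqc hi hj)
  have h2 : 0 < chord 1 (-(i * α) + j * α) := by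
    by_cases hd : (q : ℤ) ∣ j - i
    · exact lt_of_lt_of_le (by positivity) (h.le_chord_sub hi hj hij hd)
    · exact lt_of_lt_of_le (by positivity) (h.le_chord_sub_of_not_dvd hi hj hd)
  rw [← sub_ne_zero, ← abs_pos, abs_cos_sub_cos,
    show θ + i * α + (θ + j * α) = 2 * θ + i * α + j * α by ring,
    show θ + i * α - (θ + j * α) = -(-(i * α) + j * α) by ring, chord_one_neg]
  positivity

theorem Scale.prod_div_le {α : ℝ} {q ℓ : ℕ} {p : ℤ} {u : ℝ} (h : Scale α q ℓ p u) {θ c : ℝ}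
    (hc : 0 < c) (hθ : ∀ k : ℤ, c / (1 + k ^ 2) ≤ chord 1 (2 * θ + k * α)) (hqc : 1000 ≤ q * c)
    {x : ℝ} (hx : x ∈ Set.Icc (-1 : ℝ) 1) {i : ℤ} (hi : i ∈ I₁ q ∪ I₂ q ℓ) :
    ∏ j ∈ (I₁ q ∪ I₂ q ℓ).erase i, |x - cos (2 * π * (θ + j * α))| /
        |cos (2 * π * (θ + i * α)) - cos (2 * π * (θ + j * α))| ≤
      exp (log 16 + 18 * √q + 2 * ((2 * √q + 6) * (33 * log q + log 3))) * u ^ 9 := by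
  have hq := h.q_pos
  have hu := h.u_pos
  obtain ⟨a, ha⟩ : ∃ a, x = cos (2 * π * a) :=
    ⟨arccos x / (2 * π), by rw [mul_div_cancel₀ _ (by positivity), cos_arccos hx.1 hx.2]⟩
  have hterm : ∀ j : ℤ, |x - cos (2 * π * (θ + j * α))| /
      |cos (2 * π * (θ + i * α)) - cos (2 * π * (θ + j * α))| =
      (chord 1 (a + θ + j * α) * chord 1 (θ - a + j * α)) /
        (chord 1 (2 * θ + i * α + j * α) * chord 1 (-(i * α) + j * α)) := by
    intro j
    rw [ha, abs_cos_sub_cos, abs_cos_sub_cos,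
      show θ + i * α + (θ + j * α) = 2 * θ + i * α + j * α by ring,
      show θ + i * α - (θ + j * α) = -(-(i * α) + j * α) by ring, chord_one_neg,
      show a + (θ + j * α) = a + θ + j * α by ring,
      show a - (θ + j * α) = -(θ - a + j * α) by ring, chord_one_neg,
      div_div_div_cancel_right₀ two_ne_zero]
  set L := exp (-(4 * √q)) * (1 / (q : ℝ) ^ 33 / 3) ^ (2 * √q + 6) with hL
  have hLexp : L = exp (-(4 * √q + (2 * √q + 6) * (33 * log q + log 3))) := by
    have h1 : log (1 / (q : ℝ) ^ 33 / 3) = -(33 * log q + log 3) := by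
      rw [log_div (by positivity) (by norm_num), one_div, log_inv, log_pow]
      push_cast
      ring
    rw [hL, rpow_def_of_pos (by positivity), h1, ← exp_add]
    congr 1
    ring
  have hL0 : 0 < L := by rw [hLexp]; exact exp_pos _
  have hU : ∀ z, ∏ j ∈ (I₁ q ∪ I₂ q ℓ).erase i, chord 1 (z + j * α) ≤ 4 * exp (5 * √q) :=
    fun z => prod_erase_chord_le h.two_le h.one_le h.coprime h.perturb z hi
  have hnn : ∀ z, 0 ≤ ∏ j ∈ (I₁ q ∪ I₂ q ℓ).erase i, chord 1 (z + j * α) :=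
    fun z => prod_nonneg fun _ _ => chord_nonneg _ _
  rw [prod_congr rfl fun j _ => hterm j, prod_div_distrib, prod_mul_distrib, prod_mul_distrib]
  calc _ ≤ (4 * exp (5 * √q)) * (4 * exp (5 * √q)) / (L * (L * (1 / u ^ 9))) :=
        div_le_div₀ (by positivity) (mul_le_mul (hU _) (hU _) (hnn _) (by positivity))
          (by positivity) (mul_le_mul (h.le_prod_chord_add hc hθ hqc hi)
            (h.le_prod_chord_sub hi) (by positivity) (hnn _))
    _ = 16 * exp (5 * √q) * exp (5 * √q) * L⁻¹ * L⁻¹ * u ^ 9 := by field_simp; norm_num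
    _ = _ := by
        rw [hLexp, ← exp_neg]
        nth_rw 1 [← exp_log (show (0 : ℝ) < 16 by norm_num)]
        rw [← exp_add, ← exp_add, ← exp_add, ← exp_add]
        congr 2
        ring

theorem isLittleO_error (C : ℝ) :
    (fun x : ℝ => C + 18 * √x + 2 * ((2 * √x + 6) * (33 * log x + log 3))) =o[atTop]
      (fun x : ℝ => x) := by
  have hsq : (fun x : ℝ => √x * √x) =ᶠ[atTop] fun x => x := by
    filter_upwards [eventually_ge_atTop 0] with x hx using mul_self_sqrt hx
  have hconst : ∀ c : ℝ, (fun _ : ℝ => c) =o[atTop] fun x : ℝ => √x := fun c =>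
    isLittleO_const_left.2 (Or.inr (tendsto_norm_atTop_atTop.comp tendsto_sqrt_atTop))
  have hone : (fun _ : ℝ => (1 : ℝ)) =o[atTop] fun x : ℝ => √x := hconst 1
  have hlog : (fun x : ℝ => 33 * log x + log 3) =o[atTop] fun x : ℝ => √x := by
    have := isLittleO_log_rpow_atTop (show (0 : ℝ) < 1 / 2 by norm_num)
    simp only [← sqrt_eq_rpow] at this
    exact (this.const_mul_left 33).add (hconst _)
  have hlin : (fun x : ℝ => 2 * √x + 6) =O[atTop] fun x : ℝ => √x :=
    ((isBigO_refl _ _).const_mul_left 2).add (hconst 6).isBigO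
  have hmain := (hlin.mul_isLittleO hlog).congr' EventuallyEq.rfl hsq
  have hs : (fun x : ℝ => √x) =o[atTop] fun x : ℝ => x := by
    have := (hone.mul_isBigO (isBigO_refl (fun x : ℝ => √x) atTop)).congr' EventuallyEq.rfl hsq
    simpa using this
  exact (((hconst C).trans hs).add (hs.const_mul_left 18)).add (hmain.const_mul_left 2)

theorem eventually_log_q_lt {α : ℝ} (hα : Irrational α) (hβ_pos : 0 < beta α)
    (hβ_fin : beta α < ⊤) {ε : ℝ} (hε : 0 < ε) :
    ∀ᶠ n in atTop, log (q α (n + 1)) < ((beta α).toReal + ε) * q α n := by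
  have hlt : beta α < (((beta α).toReal + ε : ℝ) : EReal) := by
    conv_lhs => rw [← EReal.coe_toReal hβ_fin.ne (ne_bot_of_gt hβ_pos)]
    exact_mod_cast lt_add_of_pos_right _ hε
  filter_upwards [eventually_lt_of_limsup_lt hlt] with n hn
  have hq : (0 : ℝ) < q α n := by exact_mod_cast q_pos hα n
  rwa [EReal.coe_lt_coe_iff, div_lt_iff₀ hq] at hn

theorem exists_scale {α : ℝ} (hα : Irrational α) {n ℓ : ℕ} (hn : 16 ^ 8 ≤ q α n) (hℓ : 1 ≤ ℓ)
    (hlen : (ℓ : ℝ) ≤ (q α (n + 1) : ℝ) ^ (8 / 9 : ℝ) / (q α n : ℝ)) :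
    ∃ p u, Scale α (q α n) ℓ p u ∧ u ^ 9 = q α (n + 1) := by
  have hq : (0 : ℝ) < q α n := by exact_mod_cast q_pos hα n
  have hℓ' : (1 : ℝ) ≤ ℓ := by exact_mod_cast hℓ
  obtain ⟨p, hp, h1, h2⟩ := exists_numerator hα n
  set u : ℝ := (q α (n + 1) : ℝ) ^ (1 / 9 : ℝ) with hu
  have hu0 : 0 ≤ u := by positivity
  have hu9 : u ^ 9 = q α (n + 1) := by
    rw [hu, ← rpow_mul_natCast (by positivity)]
    norm_num
  have hu8 : u ^ 8 = (q α (n + 1) : ℝ) ^ (8 / 9 : ℝ) := by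
    rw [hu, ← rpow_mul_natCast (by positivity)]
    norm_num
  have hlen' : (ℓ : ℝ) * q α n ≤ u ^ 8 := by rwa [hu8, ← le_div_iff₀ hq]
  refine ⟨p, u, ⟨by omega, hℓ, hp, ?_, hlen', by rwa [hu9], by rwa [hu9]⟩, hu9⟩
  have hn' : (16 : ℝ) ^ 8 ≤ q α n := by exact_mod_cast hn
  refine le_of_pow_le_pow_left₀ (n := 8) (by norm_num) hu0 ?_
  nlinarith

end

end AlmostMathieu

theorem theorem3p3 (α : ℝ) (hα : Irrational α)
    (hβ_pos : 0 < AlmostMathieu.beta α) (hβ_fin : AlmostMathieu.beta α < ⊤)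
    (θ : ℝ) (hθ : θ ∉ AlmostMathieu.R α) (ε : ℝ) (hε : 0 < ε) :
    ∃ N : ℕ, ∀ n : ℕ, N ≤ n → ∀ ℓ : ℕ, 1 ≤ ℓ →
      (ℓ : ℝ) ≤ (AlmostMathieu.q α (n + 1) : ℝ) ^ (8 / 9 : ℝ) / (AlmostMathieu.q α n : ℝ) →
      AlmostMathieu.IsUniform
        (AlmostMathieu.I₁ (AlmostMathieu.q α n) ∪ AlmostMathieu.I₂ (AlmostMathieu.q α n) ℓ)
        (fun j : ℤ => θ + j * α)
        (2 * AlmostMathieu.q α n - 1)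
        ((AlmostMathieu.beta α).toReal / 2 + ε) := by
  obtain ⟨c, hc, hθc⟩ := AlmostMathieu.exists_le_chord_of_notMem_R hθ
  have hqtop := AlmostMathieu.tendsto_q hα
  have hqtopR : Filter.Tendsto (fun n => (AlmostMathieu.q α n : ℝ)) Filter.atTop Filter.atTop :=
    tendsto_natCast_atTop_atTop.comp hqtop
  have herr := hqtopR.eventually ((AlmostMathieu.isLittleO_error
    (Real.log 16 + (AlmostMathieu.beta α).toReal / 2 + ε)).def (half_pos hε))
  obtain ⟨N, hN⟩ := Filter.eventually_atTop.1 (((hqtop.eventually_ge_atTop (16 ^ 8)).and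
    (hqtopR.eventually_ge_atTop (1000 / c))).and
    ((AlmostMathieu.eventually_log_q_lt hα hβ_pos hβ_fin hε).and herr))
  refine ⟨N, fun n hn ℓ hℓ hlen => ?_⟩
  obtain ⟨⟨hq8, hqc⟩, hlog, herr⟩ := hN n hn
  rw [div_le_iff₀ hc] at hqc
  obtain ⟨p, u, hS, hu⟩ := AlmostMathieu.exists_scale hα hq8 hℓ hlen
  refine ⟨?_, ?_, ?_⟩
  · rw [AlmostMathieu.card_blocks hS.two_le hℓ]
    omega
  · intro i hi j hj hij
    by_contra hne
    exact hS.cos_ne_cos hc hθc hqc hi hj (Ne.symm hne) hij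
  · intro x hx i hi
    refine (hS.prod_div_le hc hθc hqc hx hi).trans_lt ?_
    have hq1 : (0 : ℝ) < AlmostMathieu.q α (n + 1) := by
      exact_mod_cast AlmostMathieu.q_pos hα (n + 1)
    rw [hu]
    nth_rw 1 [← Real.exp_log hq1]
    rw [← Real.exp_add, Real.exp_lt_exp, Nat.cast_sub (by omega)]
    push_cast
    have h1 := (le_abs_self _).trans herr
    rw [Real.norm_of_nonneg (Nat.cast_nonneg _)] at h1
    have h2 := mul_nonneg hε.le (Nat.cast_nonneg (α := ℝ) (AlmostMathieu.q α n))
    linarith
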